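/- Let $\mathcal G_n$ be the set of simple graphs on $n$ labelled nodes. Write $G\sim G'$ if there is a node $i$ such that every edge in the symmetric difference of $G,G'\in\mathcal G_n$ is incident on $i$. A randomized algorithm $\mathcal A$ on $\mathcal G_n$ is $(\varepsilon,\delta)$-node-differentially private if $\Pr[\mathcal A(G)\in R]\le e^{\varepsilon}\Pr[\mathcal A(G')\in R]+\delta$ for all $G\sim G'$ and all measurable $R$. For $f:\mathcal G_n\to\mathbb R$ let $LS_f(G)=\max_{G'\sim G}|f(G)-f(G')|$. For $G=(V,E)\in\mathcal G_n$ let $p_G=|E|/\binom n2$ and $\bar d_G=(n-1)p_G$ (for $n\le 1$, where $\mathcal G_n$ has one element, quotients by $0$ are read as $0$). For reals $k\ge 0$ and $\beta>0$, let $k_G$ be the smallest positive integer such that at most $k_G$ vertices have degree outside $I_G=[\bar d_G-k-3k_G,\ \bar d_G+k+3k_G]$; let $t_v$ be the distance from $\deg_G(v)$ to $I_G$, $\mathrm{wt}(v)=\max(0,1-\beta t_v)$, $\mathrm{wt}(\{u,v\})=\min(\mathrm{wt}(u),\mathrm{wt}(v))$, and, with $x_e$ the indicator of $e\in E$, $\mathrm{val}(e)=\mathrm{wt}(e)\,x_e+(1-\mathrm{wt}(e))\,p_G$.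 Let $f_{\beta,k}(G)=\sum_{\{u,v\}}\mathrm{val}(\{u,v\})$, over unordered pairs of distinct vertices, and $g_{\beta,k}(x)=x+k+\beta x(x+k)+1/\beta$. Call a constant $c>0$ admissible if $LS_{f_{\beta,k}}(G)\le c\,g_{\beta,k}(k_G)$ for all $n$, all $\beta>0$, $k\ge0$ and all $G\in\mathcal G_n$. **Algorithm 1** (input $G$, parameters $\varepsilon>0$, $k\ge0$). Let $\beta=\min(\varepsilon,1/\sqrt k)$ (so $\beta=\varepsilon$ if $k=0$) and $s=\max_{\ell\ge0}c\,e^{-\beta\ell}g_{\beta,k}(k_G+\ell)$, over real $\ell\ge 0$, where $c$ is an admissible constant. Return $\binom n2^{-1}\left(f_{\beta,k}(G)+\frac{s}{\varepsilon}Z\right)$, where $Z$ has Student's $t$-distribution with three degrees of freedom, either in its usual normalization (density $\propto(1+z^2/3)^{-2}$) or rescaled to have density $\propto(1+z^2)^{-2}$. **Algorithm 2** (input $G\in\mathcal G_n$, parameters $\varepsilon,\alpha>0$). Let $\tilde p'=p_G+\frac{2}{\varepsilon n}Z'$, where $Z'$ is a standard Laplace variable (density $\frac12e^{-|z|}$)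 independent of $Z$; let $\tilde p=\tilde p'+\frac{4\log(1/\alpha)}{\varepsilon n}$ and $\tilde k=\sqrt{\max(0,\ \tilde p\,n\log(n/\alpha))}$. Return the output of Algorithm 1 on $G$ with parameters $\varepsilon$ and $\tilde k$. **Theorem.** Admissible constants $c$ exist. Moreover there is an absolute constant $C>0$ such that for every admissible $c$, for both normalizations of the Student noise, and for all $n$, $\varepsilon>0$ and $\alpha>0$, Algorithm 2 is $(C\varepsilon,0)$-node-differentially private. -/

import Mathlib

open MeasureTheory
open scoped NNReal ENNReal

noncomputable section

namespace NodeDP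

/-! ### Node adjacency, sensitivity and node-differential privacy on `n`-node graphs -/

/-- `G` and `G'` are node-adjacent: there is a single node `i` such that every edge in the
symmetric difference of `G` and `G'` is incident on `i`. -/
def NodeAdjacent {n : ℕ} (G G' : SimpleGraph (Fin n)) : Prop :=
  ∃ i : Fin n, ∀ e ∈ symmDiff G.edgeSet G'.edgeSet, i ∈ e

/-- The local sensitivity `LS_f(G)`: the maximum of `|f G - f G'|` over `G'` node-adjacent to `G`
(a maximum over a finite type). -/
def localSensitivity {n : ℕ} (f : SimpleGraph (Fin n) → ℝ) (G : SimpleGraph (Fin n)) : ℝ :=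
  ⨆ G' : {G' : SimpleGraph (Fin n) // NodeAdjacent G G'}, |f G - f G'.1|

/-- A randomized algorithm on `n`-node graphs, given by the law `M G` of its output on each input
`G`, is `(ε, δ)`-node-differentially private. That each `M G` is a probability distribution is part
of the definition. -/
structure IsNodeDP {n : ℕ} {R : Type*} [MeasurableSpace R]
    (M : SimpleGraph (Fin n) → Measure R) (ε δ : ℝ) : Prop where
  isProbabilityMeasure : ∀ G, IsProbabilityMeasure (M G)
  le : ∀ G G', NodeAdjacent G G' → ∀ S : Set R, MeasurableSet S →
    M G S ≤ ENNReal.ofReal (Real.exp ε) * M G' S + ENNReal.ofReal δ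

/-! ### Noise distributions -/

/-- The standard Laplace distribution, with density `exp (-|z|) / 2`. -/
def laplace : Measure ℝ :=
  volume.withDensity fun z => ENNReal.ofReal (Real.exp (-|z|) / 2)

/-- Student's t-distribution with three degrees of freedom, with density proportional to
`1 / (1 + z ^ 2 / a) ^ 2`. For `a = 3` this is the usual normalization (variance `3`); for `a = 1` it
is the law of `X / √(Y₁ ^ 2 + Y₂ ^ 2 + Y₃ ^ 2)` for independent standard normal variables. -/
def studentT3 (a : ℝ) : Measure ℝ :=
  volume.withDensity fun z =>
    ENNReal.ofReal (2 / (Real.pi * Real.sqrt a) * (1 / (1 + z ^ 2 / a) ^ 2))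

/-! ### The estimator for concentrated-degree graphs -/

open Classical in
/-- The empirical edge density `p_G = |E| / (n choose 2)`. -/
def edgeDensity {n : ℕ} (G : SimpleGraph (Fin n)) : ℝ :=
  (G.edgeFinset.card : ℝ) / (n.choose 2 : ℝ)

/-- The empirical average degree. -/
def avgDegree {n : ℕ} (G : SimpleGraph (Fin n)) : ℝ :=
  ((n : ℝ) - 1) * edgeDensity G

open Classical in
/-- The degree of a vertex, as a real number. -/
def deg {n : ℕ} (G : SimpleGraph (Fin n)) (v : Fin n) : ℝ := (G.degree v : ℝ)

/-- The interval of all reals at distance at most `k + 3 m` from the average degree. -/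
def degInterval {n : ℕ} (k : ℝ) (m : ℕ) (G : SimpleGraph (Fin n)) : Set ℝ :=
  Set.Icc (avgDegree G - k - 3 * m) (avgDegree G + k + 3 * m)

/-- `k_G`, for the parameter `k`: the smallest positive integer `m` such that at most `m` vertices
have degree outside of `degInterval k m G`. -/
def kG {n : ℕ} (k : ℝ) (G : SimpleGraph (Fin n)) : ℕ :=
  sInf {m : ℕ | 0 < m ∧ {v : Fin n | deg G v ∉ degInterval k m G}.ncard ≤ m}

/-- `t_v`: the distance between the degree of `v` and the interval `I_G`. -/
def tDist {n : ℕ} (k : ℝ) (G : SimpleGraph (Fin n)) (v : Fin n) : ℝ :=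
  Metric.infDist (deg G v) (degInterval k (kG k G) G)

/-- The weight of a vertex. -/
def vertexWt {n : ℕ} (β k : ℝ) (G : SimpleGraph (Fin n)) (v : Fin n) : ℝ :=
  max 0 (1 - β * tDist k G v)

/-- The weight of a pair of vertices. -/
def pairWt {n : ℕ} (β k : ℝ) (G : SimpleGraph (Fin n)) (u v : Fin n) : ℝ :=
  min (vertexWt β k G u) (vertexWt β k G v)

open Classical in
/-- The value of a pair of vertices. -/
def pairVal {n : ℕ} (β k : ℝ) (G : SimpleGraph (Fin n)) (u v : Fin n) : ℝ :=
  pairWt β k G u v * (if G.Adj u v then 1 else 0) + (1 - pairWt β k G u v) * edgeDensity G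

/-- `f(G)`: the total value of all unordered pairs of distinct vertices. -/
def totalVal {n : ℕ} (β k : ℝ) (G : SimpleGraph (Fin n)) : ℝ :=
  ∑ u : Fin n, ∑ v ∈ Finset.Ioi u, pairVal β k G u v

/-- `x + k + β x (x + k) + 1 / β`, which at `x = k_G` is the bound
`(k_G + k) (1 + β k_G) + 1 / β` on the local sensitivity of `f`, up to a constant. -/
def sensBound (β k x : ℝ) : ℝ := x + k + β * x * (x + k) + 1 / β

/-- `c` is an admissible constant in the bound `LS_f(G) = O((k_G + k) (1 + β k_G) + 1 / β)` on the
local sensitivity of `f`, uniformly over all `n`, `β`, `k` and all graphs `G`. -/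
def IsSensitivityConstant (c : ℝ) : Prop :=
  0 < c ∧ ∀ (n : ℕ) (β k : ℝ), 0 < β → 0 ≤ k → ∀ G : SimpleGraph (Fin n),
    localSensitivity (totalVal β k) G ≤ c * sensBound β k (kG k G)

/-- `s`: the maximum over real `ℓ ≥ 0` of `c exp (-β ℓ)` times the bound with `k_G + ℓ` in place
of `k_G`. -/
def smoothBound {n : ℕ} (c β k : ℝ) (G : SimpleGraph (Fin n)) : ℝ :=
  ⨆ l : ℝ≥0, c * Real.exp (-β * l) * sensBound β k (kG k G + l)

/-- `β = min (ε, 1 / √k)`, where `1 / √0` is read as infinity. -/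
def betaOf (ε k : ℝ) : ℝ := if k = 0 then ε else min ε (1 / Real.sqrt k)

/-- The estimator for concentrated-degree graphs, with parameters `ε` and `k`, as a function of
the input graph `G` and of the value `z` of its noise variable. -/
def concentratedEstimator {n : ℕ} (c ε k : ℝ) (G : SimpleGraph (Fin n)) (z : ℝ) : ℝ :=
  1 / (n.choose 2 : ℝ) *
    (totalVal (betaOf ε k) k G + smoothBound c (betaOf ε k) k G / ε * z)

/-! ### The estimator for the parameter of an Erdős–Rényi graph -/

/-- The noisy edge density, where `z` is the value of the Laplace noise. -/
def noisyDensity {n : ℕ} (ε : ℝ) (G : SimpleGraph (Fin n)) (z : ℝ) : ℝ :=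
  edgeDensity G + 2 / (ε * n) * z

/-- The concentration parameter computed from the noisy edge density `p`. The square root of a
negative number is `0`. -/
def concentrationParam (n : ℕ) (ε α p : ℝ) : ℝ :=
  Real.sqrt ((p + 4 * Real.log (1 / α) / (ε * n)) * n * Real.log (n / α))

/-- The estimator for the Erdős–Rényi parameter, as a function of the input graph `G` and of the
values `z.1` of the Laplace noise and `z.2` of the noise of the concentrated-degree estimator. -/
def erEstimator {n : ℕ} (c ε α : ℝ) (G : SimpleGraph (Fin n)) (z : ℝ × ℝ) : ℝ :=
  concentratedEstimator c ε (concentrationParam n ε α (noisyDensity ε G z.1)) G z.2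

/-- The law of the output of the Erdős–Rényi estimator on input `G`: the Laplace noise and the
Student noise (normalized by `a`) are independent. -/
def erLaw {n : ℕ} (a c ε α : ℝ) (G : SimpleGraph (Fin n)) : Measure ℝ :=
  (laplace.prod (studentT3 a)).map (erEstimator c ε α G)

end NodeDP

end

noncomputable section

namespace NodeDP

open Filter Topology

/-! ### The noise distributions -/

/-! Privacy is adaptive composition. The edge density has node sensitivity at most `2 / n`, so the
Laplace release costs `ε`, and `concentrationParam` is post-processing of it. For a fixed `k ≥ 0`
the second stage costs `7 * ε`, hence `C = 8`.

The second stage is a smooth-sensitivity argument. Moving to a neighbour changes `kG` by at most one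
(`AdjacentAt.kG_le`), so `smoothBound` changes by a factor of at most `exp β ≤ exp ε`
(`smoothBound_le_exp_mul`), while admissibility bounds the change of `totalVal` by `smoothBound`.
Passing to the neighbour thus shifts the Student variable by at most `ε` and rescales it by a factor
in `[exp (-ε), exp ε]`. Its polynomial tail tolerates both: the shift costs `4 * ε` and the scaling
`3 * ε` (`studentT3_density_affine_le`).

Admissible constants exist because of `totalVal_eq`. With `defect` equal to one minus the weight,
`totalVal` is the edge count, minus a sum of defects times degree deviations, plus a sum over pairs
of defective vertices. Two neighbouring graphs have `O(kG)` defective vertices in all, and away from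
the changed node `i` defects move by `O(β)` and deviations by `O(1)`. At `i` itself the possibly
huge change of the edge count cancels against the deviation of `i`. -/

theorem lintegral_comp_affine {f : ℝ → ℝ≥0∞} (hf : Measurable f) (t : ℝ) {r : ℝ} (hr : 0 < r) :
    ∫⁻ z, f z = ENNReal.ofReal r * ∫⁻ w, f (t + r * w) := by
  have h1 : ∫⁻ z, f z = ∫⁻ z, f (t + z) := (lintegral_add_left_eq_self f t).symm
  have h2 := lintegral_map (μ := (volume : Measure ℝ)) (f := fun z => f (t + z))
    (g := fun w => r * w) (by fun_prop) (by fun_prop)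
  rw [Real.map_volume_mul_left hr.ne', lintegral_smul_measure, smul_eq_mul] at h2
  rw [h1, ← h2, ← mul_assoc, ← ENNReal.ofReal_mul hr.le, abs_of_pos (inv_pos.2 hr),
    mul_inv_cancel₀ hr.ne', ENNReal.ofReal_one, one_mul]

/-- Integrals against a density change by a factor of at most `e` under an affine change of
variables, if the density does. -/
theorem lintegral_withDensity_le_of_affine {h g : ℝ → ℝ≥0∞} (hh : Measurable h)
    (hg : Measurable g) (t : ℝ) {r : ℝ} (hr : 0 < r) (e : ℝ≥0∞)
    (hle : ∀ w, ENNReal.ofReal r * h (t + r * w) ≤ e * h w) :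
    ∫⁻ z, g z ∂(volume.withDensity h) ≤
      e * ∫⁻ w, g (t + r * w) ∂(volume.withDensity h) := by
  rw [lintegral_withDensity_eq_lintegral_mul _ hh hg,
    lintegral_withDensity_eq_lintegral_mul _ hh (by fun_prop),
    lintegral_comp_affine (hh.mul hg) t hr, ← lintegral_const_mul _ (by fun_prop),
    ← lintegral_const_mul _ (by fun_prop)]
  refine lintegral_mono fun w => ?_
  simp only [Pi.mul_apply, ← mul_assoc]
  exact mul_le_mul_left (hle w) _

theorem isProbabilityMeasure_withDensity_ofReal {f : ℝ → ℝ} (hf : ∀ x, 0 ≤ f x)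
    (h : ∫ x, f x = 1) :
    IsProbabilityMeasure (volume.withDensity fun x => ENNReal.ofReal (f x)) := by
  have hi : Integrable f := Integrable.of_integral_ne_zero (by simp [h])
  refine ⟨?_⟩
  rw [withDensity_apply _ MeasurableSet.univ, Measure.restrict_univ,
    ← ofReal_integral_eq_lintegral_ofReal hi (ae_of_all _ hf), h, ENNReal.ofReal_one]

instance : IsProbabilityMeasure laplace := by
  refine isProbabilityMeasure_withDensity_ofReal (fun x => by positivity) ?_
  rw [integral_comp_abs (f := fun x => Real.exp (-x) / 2), integral_div, integral_exp_neg_Ioi_zero]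
  norm_num

theorem integral_one_div_one_add_sq_sq : ∫ x : ℝ, 1 / (1 + x ^ 2) ^ 2 = Real.pi / 2 := by
  have hd : ∀ x : ℝ, HasDerivAt (fun x => (Real.arctan x + x * (1 + x ^ 2)⁻¹) / 2)
      (1 / (1 + x ^ 2) ^ 2) x := by
    intro x
    have hx : (1 + x ^ 2 : ℝ) ≠ 0 := by positivity
    have h1 := ((hasDerivAt_id x).pow 2).const_add 1
    have h2 := ((Real.hasDerivAt_arctan x).add ((hasDerivAt_id x).mul (h1.inv hx))).div_const 2
    refine h2.congr_deriv ?_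
    simp only [id, Pi.pow_apply, Pi.inv_apply]
    field_simp
    ring
  have hi : Integrable fun x : ℝ => 1 / (1 + x ^ 2) ^ 2 := by
    refine integrable_inv_one_add_sq.mono'
      (Measurable.aestronglyMeasurable (by fun_prop)) (ae_of_all _ fun x => ?_)
    rw [Real.norm_of_nonneg (by positivity), one_div]
    exact inv_anti₀ (by positivity) (by nlinarith [sq_nonneg x])
  have hlim : ∀ l : Filter ℝ, Tendsto (fun x : ℝ => x⁻¹) l (𝓝 0) → (∀ᶠ x in l, x ≠ 0) →
      Tendsto (fun x : ℝ => x * (1 + x ^ 2)⁻¹) l (𝓝 0) := by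
    intro l hl hl0
    -- In terms of `x⁻¹` the expression is continuous at `0`, which treats both ends of the line at
    -- once.
    have h : Tendsto (fun x : ℝ => x⁻¹ * (1 + x⁻¹ ^ 2)⁻¹) l (𝓝 (0 * (1 + 0 ^ 2)⁻¹)) :=
      hl.mul (((hl.pow 2).const_add 1).inv₀ (by norm_num))
    rw [zero_mul] at h
    refine h.congr' ?_
    filter_upwards [hl0] with x hx
    field_simp
    ring
  have hbot := ((tendsto_nhds_of_tendsto_nhdsWithin Real.tendsto_arctan_atBot).add
    (hlim _ tendsto_inv_atBot_zero (eventually_ne_atBot 0))).div_const 2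
  have htop := ((tendsto_nhds_of_tendsto_nhdsWithin Real.tendsto_arctan_atTop).add
    (hlim _ tendsto_inv_atTop_zero (eventually_ne_atTop 0))).div_const 2
  rw [integral_of_hasDerivAt_of_tendsto hd hi hbot htop]
  ring

theorem isProbabilityMeasure_studentT3 {a : ℝ} (ha : 0 < a) :
    IsProbabilityMeasure (studentT3 a) := by
  refine isProbabilityMeasure_withDensity_ofReal (fun x => by positivity) ?_
  have h := Measure.integral_comp_div (fun x : ℝ => 1 / (1 + x ^ 2) ^ 2) (Real.sqrt a)
  simp only [div_pow, Real.sq_sqrt ha.le] at h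
  rw [integral_const_mul, h, integral_one_div_one_add_sq_sq, abs_of_nonneg (Real.sqrt_nonneg a),
    smul_eq_mul]
  have := (Real.sqrt_pos.2 ha).ne'
  field_simp

theorem one_add_sq_div_le {a x y e : ℝ} (ha : 1 ≤ a) (he : 0 ≤ e) (hxy : |x - y| ≤ e) :
    1 + y ^ 2 / a ≤ Real.exp (2 * e) * (1 + x ^ 2 / a) := by
  have ha0 : 0 < a := by linarith
  have h1 : 1 + 2 * e + 2 * e ^ 2 ≤ Real.exp (2 * e) := by
    have := Real.quadratic_le_exp_of_nonneg (x := 2 * e) (by positivity)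
    linarith
  have h2 : 1 + y ^ 2 / a ≤ (1 + 2 * e + 2 * e ^ 2) * (1 + x ^ 2 / a) := by
    have h3 : y ^ 2 ≤ x ^ 2 + e * (1 + x ^ 2) + e ^ 2 := by
      obtain ⟨h4, h5⟩ := abs_le.1 hxy
      have h6 : (x - y) ^ 2 ≤ e ^ 2 := sq_le_sq' h4 h5
      -- The cross term `2 * x * (x - y)` is at most `e * (1 + x ^ 2)` in absolute value, by `2 *
      -- |x| ≤ 1 + x ^ 2`.
      nlinarith [mul_nonneg (sub_nonneg.2 h5) (sq_nonneg (x + 1)),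
        mul_nonneg (by linarith : 0 ≤ e + (x - y)) (sq_nonneg (x - 1)),
        mul_nonneg (sub_nonneg.2 h5) (sq_nonneg (x - 1)),
        mul_nonneg (by linarith : 0 ≤ e + (x - y)) (sq_nonneg (x + 1))]
    have h7 : y ^ 2 / a ≤ (x ^ 2 + e * (1 + x ^ 2) + e ^ 2) / a := by gcongr
    have h8 : (x ^ 2 + e * (1 + x ^ 2) + e ^ 2) / a
        = x ^ 2 / a + e * (1 / a) + e * (x ^ 2 / a) + e ^ 2 * (1 / a) := by ring
    have h9 : 1 / a ≤ 1 := by rw [div_le_one ha0]; exact ha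
    have h10 : 0 ≤ x ^ 2 / a := by positivity
    nlinarith [mul_nonneg he h10, mul_nonneg (sq_nonneg e) h10,
      mul_le_mul_of_nonneg_left h9 he, mul_le_mul_of_nonneg_left h9 (sq_nonneg e)]
  exact h2.trans (by gcongr)

/-- For `r ≥ 1` only the Jacobian `r` has to be paid for. For `r ≤ 1` the squared denominator loses
`r ^ 4` and the Jacobian gives back `r`; the net `r ^ 3` is the source of `3 * e`. -/
theorem mul_one_add_sq_div_sq_le {a r w e : ℝ} (ha : 0 < a) (hr : 0 < r) (he : 0 ≤ e)
    (hr1 : r ≤ Real.exp e) (hr2 : 1 ≤ Real.exp e * r) :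
    r * (1 + w ^ 2 / a) ^ 2 ≤ Real.exp (3 * e) * (1 + (r * w) ^ 2 / a) ^ 2 := by
  have h0 : 0 ≤ w ^ 2 / a := by positivity
  have hrw : (r * w) ^ 2 / a = r ^ 2 * (w ^ 2 / a) := by ring
  have h3 : Real.exp (3 * e) = Real.exp e ^ 3 := by rw [← Real.exp_nat_mul]; norm_num
  have h1 : 1 ≤ Real.exp e := Real.one_le_exp he
  rw [hrw, h3]
  set E := Real.exp e
  rcases le_total 1 r with h | h
  · have h4 : 1 + w ^ 2 / a ≤ 1 + r ^ 2 * (w ^ 2 / a) := by nlinarith [one_le_pow₀ h (n := 2)]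
    have h5 : r ≤ E ^ 3 := hr1.trans (le_self_pow₀ h1 (by norm_num))
    gcongr
  · have h4 : r ^ 2 * (1 + w ^ 2 / a) ≤ 1 + r ^ 2 * (w ^ 2 / a) := by
      nlinarith [pow_le_one₀ hr.le h (n := 2)]
    have h5 : 1 ≤ (E * r) ^ 3 := one_le_pow₀ hr2
    calc r * (1 + w ^ 2 / a) ^ 2 ≤ (E * r) ^ 3 * (r * (1 + w ^ 2 / a) ^ 2) :=
          le_mul_of_one_le_left (by positivity) h5
      _ = E ^ 3 * (r ^ 2 * (1 + w ^ 2 / a)) ^ 2 := by ring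
      _ ≤ _ := by gcongr

/-- The Student density changes by a factor of at most `exp (7 e)` under a shift by at most `e`
combined with a rescaling by a factor in `[exp (-e), exp e]`. -/
theorem studentT3_density_affine_le {a r t w e : ℝ} (ha : 1 ≤ a) (hr : 0 < r) (ht : |t| ≤ e)
    (hr1 : r ≤ Real.exp e) (hr2 : 1 ≤ Real.exp e * r) :
    r * (2 / (Real.pi * Real.sqrt a) * (1 / (1 + (t + r * w) ^ 2 / a) ^ 2)) ≤
      Real.exp (7 * e) * (2 / (Real.pi * Real.sqrt a) * (1 / (1 + w ^ 2 / a) ^ 2)) := by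
  have ha0 : 0 < a := by linarith
  have he : 0 ≤ e := (abs_nonneg t).trans ht
  have h1 := mul_one_add_sq_div_sq_le (w := w) ha0 hr he hr1 hr2
  have h2 := one_add_sq_div_le (x := t + r * w) (y := r * w) ha he (by simpa using ht)
  have h3 : Real.exp (7 * e) = Real.exp (3 * e) * Real.exp (2 * e) ^ 2 := by
    rw [← Real.exp_nat_mul, ← Real.exp_add]; ring_nf
  have h4 : r * (1 + w ^ 2 / a) ^ 2 ≤ Real.exp (7 * e) * (1 + (t + r * w) ^ 2 / a) ^ 2 := by
    rw [h3, mul_assoc, ← mul_pow]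
    exact h1.trans (by gcongr)
  have h5 : r * (1 / (1 + (t + r * w) ^ 2 / a) ^ 2) ≤
      Real.exp (7 * e) * (1 / (1 + w ^ 2 / a) ^ 2) := by
    rw [mul_one_div, mul_one_div, div_le_div_iff₀ (by positivity) (by positivity)]
    exact h4
  calc _ = 2 / (Real.pi * Real.sqrt a) * (r * (1 / (1 + (t + r * w) ^ 2 / a) ^ 2)) := by ring
    _ ≤ 2 / (Real.pi * Real.sqrt a) * (Real.exp (7 * e) * (1 / (1 + w ^ 2 / a) ^ 2)) := by gcongr
    _ = _ := by ring

theorem lintegral_studentT3_le {a r t e : ℝ} (ha : 1 ≤ a) (hr : 0 < r) (ht : |t| ≤ e)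
    (hr1 : r ≤ Real.exp e) (hr2 : 1 ≤ Real.exp e * r) {g : ℝ → ℝ≥0∞} (hg : Measurable g) :
    ∫⁻ z, g z ∂(studentT3 a) ≤
      ENNReal.ofReal (Real.exp (7 * e)) * ∫⁻ w, g (t + r * w) ∂(studentT3 a) := by
  refine lintegral_withDensity_le_of_affine (by fun_prop) hg t hr _ fun w => ?_
  rw [← ENNReal.ofReal_mul hr.le, ← ENNReal.ofReal_mul (Real.exp_nonneg _)]
  exact ENNReal.ofReal_le_ofReal (studentT3_density_affine_le ha hr ht hr1 hr2)

/-- A general integrand `g` is needed, since it will be a conditional probability given the Laplace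
noise. -/
theorem lintegral_laplace_le {t e : ℝ} (ht : |t| ≤ e) {g : ℝ → ℝ≥0∞} (hg : Measurable g) :
    ∫⁻ z, g z ∂laplace ≤ ENNReal.ofReal (Real.exp e) * ∫⁻ w, g (t + w) ∂laplace := by
  have h := lintegral_withDensity_le_of_affine (g := g)
    (h := fun z => ENNReal.ofReal (Real.exp (-|z|) / 2)) (by fun_prop) hg t one_pos
    (ENNReal.ofReal (Real.exp e)) fun w => ?_
  · simp only [one_mul] at h
    exact h
  · rw [ENNReal.ofReal_one, one_mul, one_mul, ← ENNReal.ofReal_mul (Real.exp_nonneg _),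
      ← mul_div_assoc, ← Real.exp_add]
    have : |w| ≤ |t + w| + |t| := by simpa using abs_sub (t + w) t
    gcongr
    linarith

/-! ### The smooth bound on the local sensitivity -/

theorem sensBound_pos {β k x : ℝ} (hβ : 0 < β) (hk : 0 ≤ k) (hx : 0 ≤ x) :
    0 < sensBound β k x := by
  unfold sensBound
  positivity

theorem sensBound_mono {β k x y : ℝ} (hβ : 0 < β) (hk : 0 ≤ k) (hx : 0 ≤ x) (hxy : x ≤ y) :
    sensBound β k x ≤ sensBound β k y := by
  have hy := hx.trans hxy
  unfold sensBound
  gcongr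

theorem mul_exp_neg_mul_le {β l : ℝ} (hβ : 0 < β) : l * Real.exp (-β * l) ≤ 1 / β := by
  rw [neg_mul, Real.exp_neg, ← div_eq_mul_inv, div_le_div_iff₀ (Real.exp_pos _) hβ]
  linarith [Real.add_one_le_exp (β * l)]

theorem sq_mul_exp_neg_mul_le {β l : ℝ} (hβ : 0 < β) (hl : 0 ≤ l) :
    l ^ 2 * Real.exp (-β * l) ≤ 2 / β ^ 2 := by
  rw [neg_mul, Real.exp_neg, ← div_eq_mul_inv, div_le_div_iff₀ (Real.exp_pos _) (by positivity)]
  nlinarith [Real.quadratic_le_exp_of_nonneg (mul_nonneg hβ.le hl), mul_nonneg hβ.le hl]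

/-- Without boundedness the real supremum defining `smoothBound` would take the default value `0`.
The bound is quadratic in `l`, and the exponential absorbs each power of `l`. -/
theorem bddAbove_exp_mul_sensBound {c β : ℝ} (hc : 0 < c) (hβ : 0 < β) {k x : ℝ} (hk : 0 ≤ k)
    (hx : 0 ≤ x) :
    BddAbove (Set.range fun l : ℝ≥0 => c * Real.exp (-β * l) * sensBound β k (x + l)) := by
  refine ⟨c * (sensBound β k x + (1 + β * (2 * x + k)) * (1 / β) + β * (2 / β ^ 2)), ?_⟩
  rintro _ ⟨l, rfl⟩
  have hl : 0 ≤ (l : ℝ) := l.2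
  have h1 := mul_exp_neg_mul_le (l := l) hβ
  have h2 := sq_mul_exp_neg_mul_le hβ hl
  have h3 : Real.exp (-β * l) ≤ 1 := Real.exp_le_one_iff.2 (by nlinarith)
  have h4 := sensBound_pos hβ hk hx
  dsimp only
  rw [mul_assoc]
  refine mul_le_mul_of_nonneg_left ?_ hc.le
  calc Real.exp (-β * l) * sensBound β k (x + l)
      = sensBound β k x * Real.exp (-β * l) + (1 + β * (2 * x + k)) * (l * Real.exp (-β * l))
          + β * (l ^ 2 * Real.exp (-β * l)) := by unfold sensBound; ring
    _ ≤ sensBound β k x * 1 + (1 + β * (2 * x + k)) * (1 / β) + β * (2 / β ^ 2) := by gcongr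
    _ = _ := by ring

theorem le_smoothBound {n : ℕ} {c β k : ℝ} (hc : 0 < c) (hβ : 0 < β) (hk : 0 ≤ k)
    (G : SimpleGraph (Fin n)) : c * sensBound β k (kG k G) ≤ smoothBound c β k G := by
  have h := le_ciSup (bddAbove_exp_mul_sensBound hc hβ hk (Nat.cast_nonneg (kG k G))) 0
  simp only [NNReal.coe_zero, mul_zero, Real.exp_zero, mul_one, add_zero] at h
  exact h

theorem smoothBound_pos {n : ℕ} {c β k : ℝ} (hc : 0 < c) (hβ : 0 < β) (hk : 0 ≤ k)
    (G : SimpleGraph (Fin n)) : 0 < smoothBound c β k G :=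
  (mul_pos hc (sensBound_pos hβ hk (Nat.cast_nonneg _))).trans_le (le_smoothBound hc hβ hk G)

/-- The term of index `l` for `G` is at most `exp β` times the term of index `l + 1` for `G'`. -/
theorem smoothBound_le_exp_mul {n : ℕ} {c β k : ℝ} (hc : 0 < c) (hβ : 0 < β) (hk : 0 ≤ k)
    {G G' : SimpleGraph (Fin n)} (h : kG k G ≤ kG k G' + 1) :
    smoothBound c β k G ≤ Real.exp β * smoothBound c β k G' := by
  refine ciSup_le fun l => ?_
  have h1 := le_ciSup (bddAbove_exp_mul_sensBound hc hβ hk (Nat.cast_nonneg (kG k G'))) (l + 1)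
  have h2 : (kG k G : ℝ) + l ≤ kG k G' + (l + 1 : ℝ≥0) := by
    have : (kG k G : ℝ) ≤ kG k G' + 1 := by exact_mod_cast h
    push_cast
    linarith
  have h3 := sensBound_mono hβ hk (by positivity) h2
  calc c * Real.exp (-β * l) * sensBound β k (kG k G + l)
      ≤ c * Real.exp (-β * l) * sensBound β k (kG k G' + (l + 1 : ℝ≥0)) := by gcongr
    _ = Real.exp β * (c * Real.exp (-β * (l + 1 : ℝ≥0)) *
          sensBound β k (kG k G' + (l + 1 : ℝ≥0))) := by
        have : Real.exp (-β * l) = Real.exp β * Real.exp (-β * (l + 1 : ℝ≥0)) := by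
          rw [← Real.exp_add]; push_cast; ring_nf
        rw [this]; ring
    _ ≤ _ := mul_le_mul_of_nonneg_left h1 (Real.exp_nonneg _)

/-! ### Adjacency, degrees and edge densities -/

/-- The indicator of adjacency. -/
def adjInd {n : ℕ} (G : SimpleGraph (Fin n)) (u v : Fin n) : ℝ :=
  open Classical in if G.Adj u v then 1 else 0

section Degrees

variable {n : ℕ} (G : SimpleGraph (Fin n))

theorem adjInd_nonneg (u v : Fin n) : 0 ≤ adjInd G u v := by
  unfold adjInd; split_ifs <;> norm_num

theorem adjInd_le_one (u v : Fin n) : adjInd G u v ≤ 1 := by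
  unfold adjInd; split_ifs <;> norm_num

theorem adjInd_comm (u v : Fin n) : adjInd G u v = adjInd G v u := by
  by_cases h : G.Adj u v <;> simp [adjInd, h, G.adj_comm v u]

theorem adjInd_self (u : Fin n) : adjInd G u u = 0 := by simp [adjInd]

theorem sum_adjInd (u : Fin n) : ∑ v, adjInd G u v = deg G u := by
  classical
  unfold adjInd deg
  rw [Finset.sum_boole, ← SimpleGraph.card_neighborFinset_eq_degree,
    SimpleGraph.neighborFinset_eq_filter]

theorem deg_nonneg (u : Fin n) : 0 ≤ deg G u := Nat.cast_nonneg _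

theorem deg_le (u : Fin n) : deg G u ≤ n - 1 := by
  classical
  have h := G.degree_lt_card_verts u
  rw [Fintype.card_fin] at h
  have h1 : (G.degree u : ℝ) + 1 ≤ n := by exact_mod_cast h
  unfold deg
  linarith

theorem cast_choose_two_pos (hn : 2 ≤ n) : (0 : ℝ) < n.choose 2 := by
  exact_mod_cast Nat.choose_pos hn

theorem sum_deg (hn : 2 ≤ n) : ∑ u, deg G u = n * (n - 1) * edgeDensity G := by
  classical
  have h : (∑ u, G.degree u : ℝ) = 2 * G.edgeFinset.card := by
    exact_mod_cast G.sum_degrees_eq_twice_card_edges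
  have h1 := cast_choose_two_pos hn
  have h2 : (n : ℝ) * (n - 1) = 2 * n.choose 2 := by rw [Nat.cast_choose_two]; ring
  unfold deg edgeDensity
  rw [h, h2]
  field_simp

theorem edgeDensity_nonneg : 0 ≤ edgeDensity G := by
  unfold edgeDensity; positivity

theorem edgeDensity_le_one (hn : 2 ≤ n) : edgeDensity G ≤ 1 := by
  have h1 : (2 : ℝ) ≤ n := by exact_mod_cast hn
  have h := Finset.sum_le_sum fun u (_ : u ∈ Finset.univ) => deg_le G u
  rw [sum_deg G hn] at h
  simp only [Finset.sum_const, Finset.card_univ, Fintype.card_fin, nsmul_eq_mul] at h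
  have : 0 < (n : ℝ) * (n - 1) := by nlinarith
  nlinarith

end Degrees

/-- All edges in the symmetric difference of `G` and `G'` are incident on `i`. -/
def AdjacentAt {n : ℕ} (i : Fin n) (G G' : SimpleGraph (Fin n)) : Prop :=
  ∀ u v, u ≠ i → v ≠ i → adjInd G u v = adjInd G' u v

theorem NodeAdjacent.exists_adjacentAt {n : ℕ} {G G' : SimpleGraph (Fin n)}
    (h : NodeAdjacent G G') : ∃ i, AdjacentAt i G G' := by
  obtain ⟨i, hi⟩ := h
  refine ⟨i, fun u v hu hv => ?_⟩
  have h1 : G.Adj u v ↔ G'.Adj u v := by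
    by_contra hne
    have := hi s(u, v) (by
      rw [Set.mem_symmDiff, SimpleGraph.mem_edgeSet, SimpleGraph.mem_edgeSet]; tauto)
    rw [Sym2.mem_iff] at this
    tauto
  by_cases h : G'.Adj u v <;> simp [adjInd, h1, h]

namespace AdjacentAt

variable {n : ℕ} {i : Fin n} {G G' : SimpleGraph (Fin n)}

theorem symm (h : AdjacentAt i G G') : AdjacentAt i G' G := fun u v hu hv => (h u v hu hv).symm

theorem deg_sub_deg (h : AdjacentAt i G G') {u : Fin n} (hu : u ≠ i) :
    deg G u - deg G' u = adjInd G u i - adjInd G' u i := by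
  rw [← sum_adjInd, ← sum_adjInd, ← Finset.sum_sub_distrib]
  refine Finset.sum_eq_single i (fun v _ hv => ?_) (by simp)
  rw [h u v hu hv, sub_self]

theorem abs_deg_sub_deg_le (h : AdjacentAt i G G') {u : Fin n} (hu : u ≠ i) :
    |deg G u - deg G' u| ≤ 1 := by
  rw [h.deg_sub_deg hu, abs_le]
  constructor <;> linarith [adjInd_nonneg G u i, adjInd_nonneg G' u i, adjInd_le_one G u i,
    adjInd_le_one G' u i]

theorem sum_deg_sub (h : AdjacentAt i G G') :
    ∑ u, (deg G u - deg G' u) = 2 * (deg G i - deg G' i) := by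
  rw [← Finset.add_sum_erase _ _ (Finset.mem_univ i)]
  have h1 : ∑ u ∈ Finset.univ.erase i, (deg G u - deg G' u) = deg G i - deg G' i := by
    rw [← sum_adjInd G i, ← sum_adjInd G' i, ← Finset.sum_sub_distrib,
      ← Finset.add_sum_erase _ _ (Finset.mem_univ i), adjInd_self, adjInd_self, sub_self, zero_add]
    refine Finset.sum_congr rfl fun u hu => ?_
    rw [h.deg_sub_deg (Finset.ne_of_mem_erase hu), adjInd_comm G, adjInd_comm G']
  rw [h1]
  ring

theorem choose_mul_edgeDensity_sub (h : AdjacentAt i G G') (hn : 2 ≤ n) :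
    n * (n - 1) * (edgeDensity G - edgeDensity G') = 2 * (deg G i - deg G' i) := by
  rw [← h.sum_deg_sub, Finset.sum_sub_distrib, sum_deg G hn, sum_deg G' hn]
  ring

/-- At most `n - 1` of the `n * (n - 1) / 2` pairs contain `i`. This calibrates the Laplace scale.
-/
theorem abs_edgeDensity_sub_le (h : AdjacentAt i G G') (hn : 2 ≤ n) :
    |edgeDensity G - edgeDensity G'| ≤ 2 / n := by
  have h1 : (2 : ℝ) ≤ n := by exact_mod_cast hn
  have h2 := h.choose_mul_edgeDensity_sub hn
  have h3 : |deg G i - deg G' i| ≤ n - 1 := by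
    rw [abs_le]
    constructor <;> linarith [deg_nonneg G i, deg_nonneg G' i, deg_le G i, deg_le G' i]
  have h4 := congrArg abs h2
  rw [abs_mul, abs_mul 2, abs_two, abs_of_nonneg (by nlinarith : (0 : ℝ) ≤ n * (n - 1))] at h4
  rw [le_div_iff₀ (by linarith)]
  have h5 : (0 : ℝ) < n - 1 := by linarith
  refine le_of_mul_le_mul_right ?_ h5
  nlinarith

theorem abs_avgDegree_sub_le (h : AdjacentAt i G G') (hn : 2 ≤ n) :
    |avgDegree G - avgDegree G'| ≤ 2 := by
  have h1 : (2 : ℝ) ≤ n := by exact_mod_cast hn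
  have h2 := h.abs_edgeDensity_sub_le hn
  unfold avgDegree
  rw [← mul_sub, abs_mul, abs_of_nonneg (by linarith : (0 : ℝ) ≤ n - 1)]
  calc ((n : ℝ) - 1) * |edgeDensity G - edgeDensity G'| ≤ n * (2 / n) := by gcongr; linarith
    _ = 2 := by field_simp

/-- Away from the node `i`, the deviation of a degree from the average changes by at most `3`. -/
theorem abs_dev_sub_le (h : AdjacentAt i G G') (hn : 2 ≤ n) {u : Fin n} (hu : u ≠ i) :
    |(deg G u - avgDegree G) - (deg G' u - avgDegree G')| ≤ 3 := by
  have h1 := abs_le.1 (h.abs_deg_sub_deg_le hu)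
  have h2 := abs_le.1 (h.abs_avgDegree_sub_le hn)
  rw [abs_le]
  constructor <;> linarith [h1.1, h1.2, h2.1, h2.2]

end AdjacentAt

/-! ### The parameter `kG` and the weights -/

section Weights

variable {n : ℕ}

theorem mem_degInterval_iff {k : ℝ} {m : ℕ} {G : SimpleGraph (Fin n)} {x : ℝ} :
    x ∈ degInterval k m G ↔ |x - avgDegree G| ≤ k + 3 * m := by
  rw [degInterval, Set.mem_Icc, abs_le]
  constructor <;> rintro ⟨h1, h2⟩ <;> constructor <;> linarith

theorem kG_spec (k : ℝ) (G : SimpleGraph (Fin n)) :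
    0 < kG k G ∧ {v : Fin n | deg G v ∉ degInterval k (kG k G) G}.ncard ≤ kG k G := by
  -- The witness `n + 1` shows that the infimum is attained; `n` would fail positivity when `n = 0`.
  refine Nat.sInf_mem (s := {m : ℕ | 0 < m ∧ {v : Fin n | deg G v ∉ degInterval k m G}.ncard ≤ m})
    ⟨n + 1, n.succ_pos, ?_⟩
  have := Set.ncard_le_card {v : Fin n | deg G v ∉ degInterval k (n + 1) G}
  simp only [Nat.card_eq_fintype_card, Fintype.card_fin] at this
  omega

theorem kG_le {k : ℝ} {G : SimpleGraph (Fin n)} {m : ℕ} (hm : 0 < m)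
    (h : {v : Fin n | deg G v ∉ degInterval k m G}.ncard ≤ m) : kG k G ≤ m :=
  Nat.sInf_le ⟨hm, h⟩

/-- This is why the interval grows by `3` per unit of `m`: the growth absorbs the change of every
deviation except that of `i`, and `i` is the one additional exception allowed. -/
theorem AdjacentAt.kG_le {i : Fin n} {G G' : SimpleGraph (Fin n)} (h : AdjacentAt i G G')
    (hn : 2 ≤ n) (k : ℝ) : kG k G' ≤ kG k G + 1 := by
  refine NodeDP.kG_le (Nat.succ_pos _) ?_
  refine (Set.ncard_le_ncard (t := insert i {v : Fin n | deg G v ∉ degInterval k (kG k G) G})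
    ?_ (Set.toFinite _)).trans ((Set.ncard_insert_le _ _).trans
      (Nat.add_le_add_right (kG_spec k G).2 1))
  intro v hv
  by_cases hvi : v = i
  · exact Or.inl hvi
  refine Or.inr fun hmem => hv ?_
  rw [mem_degInterval_iff] at hmem ⊢
  have h1 := abs_le.1 (h.abs_dev_sub_le hn hvi)
  have h2 := abs_le.1 hmem
  push_cast
  rw [abs_le]
  constructor <;> linarith [h1.1, h1.2, h2.1, h2.2]

/-- Monotonicity in `k` yields measurability of `kG` in the random parameter. -/
theorem kG_antitone (G : SimpleGraph (Fin n)) : Antitone fun k => kG k G := by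
  intro k k' hk
  refine kG_le (kG_spec k G).1 (le_trans (Set.ncard_le_ncard ?_ (Set.toFinite _)) (kG_spec k G).2)
  intro v hv hmem
  refine hv ?_
  rw [mem_degInterval_iff] at hmem ⊢
  linarith

theorem infDist_Icc {a b x : ℝ} (h : a ≤ b) :
    Metric.infDist x (Set.Icc a b) = max 0 (max (a - x) (x - b)) := by
  refine le_antisymm ?_ ((Metric.le_infDist (Set.nonempty_Icc.2 h)).2 fun y hy => ?_)
  · refine (Metric.infDist_le_dist_of_mem (y := max a (min b x))
      (Set.mem_Icc.2 ⟨le_max_left _ _, by grind⟩)).trans ?_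
    rw [Real.dist_eq]
    grind
  · rw [Real.dist_eq]
    obtain ⟨h1, h2⟩ := hy
    grind

theorem tDist_eq {k : ℝ} (hk : 0 ≤ k) (G : SimpleGraph (Fin n)) (v : Fin n) :
    tDist k G v = max 0 (|deg G v - avgDegree G| - (k + 3 * kG k G)) := by
  rw [tDist, degInterval, infDist_Icc (by linarith [Nat.cast_nonneg (α := ℝ) (kG k G)])]
  grind

theorem tDist_nonneg (k : ℝ) (G : SimpleGraph (Fin n)) (v : Fin n) : 0 ≤ tDist k G v :=
  Metric.infDist_nonneg

theorem vertexWt_nonneg (β k : ℝ) (G : SimpleGraph (Fin n)) (v : Fin n) :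
    0 ≤ vertexWt β k G v := le_max_left _ _

theorem vertexWt_le_one {β : ℝ} (hβ : 0 < β) (k : ℝ) (G : SimpleGraph (Fin n)) (v : Fin n) :
    vertexWt β k G v ≤ 1 :=
  max_le zero_le_one (by linarith [mul_nonneg hβ.le (tDist_nonneg k G v)])

theorem vertexWt_eq_one {β k : ℝ} {G : SimpleGraph (Fin n)} {v : Fin n}
    (hv : deg G v ∈ degInterval k (kG k G) G) : vertexWt β k G v = 1 := by
  have : tDist k G v = 0 := Metric.infDist_zero_of_mem hv
  simp [vertexWt, this]

theorem abs_dev_le_of_vertexWt_pos {β k : ℝ} (hβ : 0 < β) (hk : 0 ≤ k) {G : SimpleGraph (Fin n)}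
    {v : Fin n} (hv : 0 < vertexWt β k G v) :
    |deg G v - avgDegree G| ≤ k + 3 * kG k G + 1 / β := by
  rw [vertexWt, lt_max_iff] at hv
  have h1 : β * tDist k G v ≤ 1 := by rcases hv with hv | hv <;> linarith
  have h2 : tDist k G v ≤ 1 / β := by rw [le_div_iff₀ hβ]; linarith
  have h3 := le_max_right 0 (|deg G v - avgDegree G| - (k + 3 * kG k G))
  rw [← tDist_eq hk] at h3
  linarith

theorem abs_max_zero_sub_max_zero_le (x y : ℝ) : |max 0 x - max 0 y| ≤ |x - y| := by
  simpa only [max_comm] using abs_max_sub_max_le_abs x y 0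

theorem AdjacentAt.abs_vertexWt_sub_le {i : Fin n} {G G' : SimpleGraph (Fin n)}
    (h : AdjacentAt i G G') (hn : 2 ≤ n) {β k : ℝ} (hβ : 0 < β) (hk : 0 ≤ k) {u : Fin n}
    (hu : u ≠ i) : |vertexWt β k G u - vertexWt β k G' u| ≤ 6 * β := by
  -- The deviation contributes `3`, and the change of `3 * kG` another `3`.
  have h1 : |tDist k G u - tDist k G' u| ≤ 6 := by
    rw [tDist_eq hk, tDist_eq hk]
    have h2 : (kG k G : ℝ) ≤ kG k G' + 1 := by exact_mod_cast h.symm.kG_le hn k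
    have h3 : (kG k G' : ℝ) ≤ kG k G + 1 := by exact_mod_cast h.kG_le hn k
    have h4 := (abs_abs_sub_abs_le _ _).trans (h.abs_dev_sub_le hn hu)
    refine (abs_max_zero_sub_max_zero_le _ _).trans ?_
    rw [abs_le] at h4 ⊢
    constructor <;> linarith [h4.1, h4.2]
  unfold vertexWt
  refine (abs_max_zero_sub_max_zero_le _ _).trans ?_
  calc |1 - β * tDist k G u - (1 - β * tDist k G' u)| = β * |tDist k G u - tDist k G' u| := by
        rw [← abs_of_pos hβ, ← abs_mul, abs_of_pos hβ, ← abs_neg]; ring_nf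
    _ ≤ β * 6 := by gcongr
    _ = 6 * β := by ring

end Weights

/-! ### The local sensitivity of `totalVal` -/

section Sensitivity

variable {n : ℕ}

/-- The deviation of a degree from the average degree. -/
def dev (G : SimpleGraph (Fin n)) (u : Fin n) : ℝ := deg G u - avgDegree G

/-- The adjacency indicator centered at the edge density, and `0` on the diagonal. -/
def centeredAdj (G : SimpleGraph (Fin n)) (u v : Fin n) : ℝ :=
  if u = v then 0 else adjInd G u v - edgeDensity G

theorem abs_centeredAdj_le (G : SimpleGraph (Fin n)) (hn : 2 ≤ n) (u v : Fin n) :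
    |centeredAdj G u v| ≤ 1 := by
  unfold centeredAdj
  split_ifs
  · simp
  · rw [abs_le]
    constructor <;> linarith [adjInd_nonneg G u v, adjInd_le_one G u v, edgeDensity_nonneg G,
      edgeDensity_le_one G hn]

theorem sum_centeredAdj (G : SimpleGraph (Fin n)) (u : Fin n) :
    ∑ v, centeredAdj G u v = dev G u := by
  have h : ∀ v, centeredAdj G u v =
      adjInd G u v - edgeDensity G + (if u = v then edgeDensity G else 0) := by
    intro v
    unfold centeredAdj
    split_ifs with h
    · rw [← h, adjInd_self]; ring
    · ring
  simp only [h, Finset.sum_add_distrib, Finset.sum_sub_distrib, sum_adjInd, Finset.sum_ite_eq,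
    Finset.mem_univ, if_true, Finset.sum_const, Finset.card_univ, Fintype.card_fin, nsmul_eq_mul]
  unfold dev avgDegree
  ring

theorem AdjacentAt.abs_centeredAdj_sub_le {i : Fin n} {G G' : SimpleGraph (Fin n)}
    (h : AdjacentAt i G G') (hn : 2 ≤ n) {u v : Fin n} (hu : u ≠ i) (hv : v ≠ i) :
    |centeredAdj G u v - centeredAdj G' u v| ≤ 2 / n := by
  unfold centeredAdj
  split_ifs
  · simp; positivity
  · rw [h u v hu hv, sub_sub_sub_cancel_left]
    exact h.symm.abs_edgeDensity_sub_le hn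

/-- The defect of a vertex: one minus its weight. -/
def defect (β k : ℝ) (G : SimpleGraph (Fin n)) (u : Fin n) : ℝ := 1 - vertexWt β k G u

/-- One minus the pair weight is the larger defect, and `max a b = a + b - min a b`. The additive
part sums to degree deviations; the `min` part vanishes unless both vertices are defective. -/
theorem pairVal_of_ne {β k : ℝ} {G : SimpleGraph (Fin n)} {u v : Fin n} (huv : v ≠ u) :
    pairVal β k G v u = adjInd G v u - defect β k G v * centeredAdj G v u
      - defect β k G u * centeredAdj G v u
      + min (defect β k G v) (defect β k G u) * centeredAdj G v u := by
  have h1 : pairWt β k G v u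
      = 1 - (defect β k G v + defect β k G u - min (defect β k G v) (defect β k G u)) := by
    unfold pairWt defect
    grind
  rw [pairVal, h1, centeredAdj, if_neg huv, adjInd]
  ring

/-- Summing the centered adjacencies along rows collapses the linear terms to one term per vertex,
so only pairs of defective vertices remain as a double sum. -/
theorem totalVal_eq (β k : ℝ) (G : SimpleGraph (Fin n)) (hn : 2 ≤ n) :
    totalVal β k G = n * (n - 1) * edgeDensity G / 2 - ∑ u, defect β k G u * dev G u
      + (∑ u, ∑ v, min (defect β k G u) (defect β k G v) * centeredAdj G u v) / 2 := by
  have hsymm : ∀ u v, pairVal β k G u v = pairVal β k G v u := by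
    intro u v
    rw [pairVal, pairVal, pairWt, pairWt, min_comm]
    have := adjInd_comm G u v
    unfold adjInd at this
    rw [this]
  have h1 : 2 * totalVal β k G = ∑ u, ∑ v ∈ {u}ᶜ, pairVal β k G v u := by
    rw [← Finset.sum_sum_Ioi_add_eq_sum_sum_off_diag, totalVal, Finset.mul_sum]
    refine Finset.sum_congr rfl fun u _ => ?_
    rw [Finset.mul_sum]
    refine Finset.sum_congr rfl fun v _ => ?_
    rw [hsymm v u, two_mul]
  have h2 : ∀ u, ∑ v ∈ {u}ᶜ, pairVal β k G v u =
      ∑ v, (adjInd G u v - defect β k G u * centeredAdj G u v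
        - defect β k G v * centeredAdj G v u
        + min (defect β k G u) (defect β k G v) * centeredAdj G u v) := by
    intro u
    rw [← Finset.sum_compl_add_sum {u}]
    simp only [Finset.sum_singleton, adjInd_self, centeredAdj, if_true]
    simp only [mul_zero, sub_zero, add_zero]
    refine Finset.sum_congr rfl fun v hv => ?_
    have hne : v ≠ u := by simpa using hv
    rw [hsymm, pairVal_of_ne hne.symm, centeredAdj, if_neg hne.symm, if_neg hne, adjInd_comm G v u]
  have h3 : ∑ u, ∑ v, defect β k G v * centeredAdj G v u = ∑ u, defect β k G u * dev G u := by
    rw [Finset.sum_comm]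
    simp only [← Finset.mul_sum, sum_centeredAdj]
  simp only [h2, Finset.sum_add_distrib, Finset.sum_sub_distrib, h3] at h1
  simp only [sum_adjInd, ← Finset.mul_sum, sum_centeredAdj, sum_deg G hn] at h1
  linarith

theorem defect_nonneg {β : ℝ} (hβ : 0 < β) (k : ℝ) (G : SimpleGraph (Fin n)) (u : Fin n) :
    0 ≤ defect β k G u := sub_nonneg.2 (vertexWt_le_one hβ k G u)

theorem defect_le_one (β k : ℝ) (G : SimpleGraph (Fin n)) (u : Fin n) :
    defect β k G u ≤ 1 := by
  linarith [vertexWt_nonneg β k G u, show defect β k G u = 1 - vertexWt β k G u from rfl]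

theorem defect_eq_zero {β k : ℝ} {G : SimpleGraph (Fin n)} {v : Fin n}
    (hv : deg G v ∈ degInterval k (kG k G) G) : defect β k G v = 0 := by
  rw [defect, vertexWt_eq_one hv, sub_self]

theorem AdjacentAt.abs_defect_sub_le {i : Fin n} {G G' : SimpleGraph (Fin n)}
    (h : AdjacentAt i G G') (hn : 2 ≤ n) {β k : ℝ} (hβ : 0 < β) (hk : 0 ≤ k) {u : Fin n}
    (hu : u ≠ i) : |defect β k G u - defect β k G' u| ≤ 6 * β := by
  rw [defect, defect, sub_sub_sub_cancel_left]
  exact h.symm.abs_vertexWt_sub_le hn hβ hk hu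

/-- A vertex of nonzero weight has deviation at most `D`. -/
theorem abs_vertexWt_mul_dev_le {β k D : ℝ} (hβ : 0 < β) (hk : 0 ≤ k) {G : SimpleGraph (Fin n)}
    (hD : k + 3 * kG k G + 1 / β ≤ D) (u : Fin n) : |vertexWt β k G u * dev G u| ≤ D := by
  have hD0 : 0 ≤ D := le_trans (by positivity) hD
  rcases (vertexWt_nonneg β k G u).eq_or_lt with h | h
  · rw [← h]; simpa using hD0
  · rw [abs_mul, abs_of_pos h]
    have h1 := (abs_dev_le_of_vertexWt_pos hβ hk h).trans hD
    calc _ ≤ 1 * D := by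
          gcongr
          exacts [vertexWt_le_one hβ k G u, h1]
      _ = D := one_mul D

/-- A product rule, expanded so that the change of defect multiplies the deviation in a graph where
`u` has positive weight, which is at most `D`. If both weights vanish, both defects are `1` and only
the change of deviation is left. -/
theorem AdjacentAt.abs_defect_mul_dev_sub_le {i : Fin n} {G G' : SimpleGraph (Fin n)}
    (h : AdjacentAt i G G') (hn : 2 ≤ n) {β k D : ℝ} (hβ : 0 < β) (hk : 0 ≤ k)
    (hD : k + 3 * kG k G + 1 / β ≤ D) (hD' : k + 3 * kG k G' + 1 / β ≤ D) {u : Fin n}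
    (hu : u ≠ i) :
    |defect β k G u * dev G u - defect β k G' u * dev G' u| ≤ 6 * β * D + 3 := by
  have hD0 : 0 ≤ D := le_trans (by positivity) hD
  have hY : |dev G u - dev G' u| ≤ 3 := h.abs_dev_sub_le hn hu
  have ha := h.abs_defect_sub_le hn hβ hk hu
  rcases (vertexWt_nonneg β k G u).eq_or_lt with h0 | h0
  · rcases (vertexWt_nonneg β k G' u).eq_or_lt with h0' | h0'
    · rw [defect, defect, ← h0, ← h0', sub_zero, one_mul, one_mul]
      exact hY.trans (by linarith [mul_nonneg hβ.le hD0])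
    · have h1 : |dev G' u| ≤ D := (abs_dev_le_of_vertexWt_pos hβ hk h0').trans hD'
      calc _ = |(defect β k G u - defect β k G' u) * dev G' u
              + defect β k G u * (dev G u - dev G' u)| := by ring_nf
        _ ≤ |defect β k G u - defect β k G' u| * |dev G' u|
              + defect β k G u * |dev G u - dev G' u| := by
            refine (abs_add_le _ _).trans ?_
            rw [abs_mul, abs_mul, abs_of_nonneg (defect_nonneg hβ k G u)]
        _ ≤ 6 * β * D + 1 * 3 := by
            gcongr
            exact defect_le_one β k G u
        _ = _ := by ring
  · have h1 : |dev G u| ≤ D := (abs_dev_le_of_vertexWt_pos hβ hk h0).trans hD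
    calc _ = |(defect β k G u - defect β k G' u) * dev G u
              + defect β k G' u * (dev G u - dev G' u)| := by ring_nf
      _ ≤ |defect β k G u - defect β k G' u| * |dev G u|
              + defect β k G' u * |dev G u - dev G' u| := by
            refine (abs_add_le _ _).trans ?_
            rw [abs_mul, abs_mul, abs_of_nonneg (defect_nonneg hβ k G' u)]
      _ ≤ 6 * β * D + 1 * 3 := by
            gcongr
            exact defect_le_one β k G' u
      _ = _ := by ring

theorem abs_min_defect_le_one {β : ℝ} (hβ : 0 < β) (k : ℝ) (G : SimpleGraph (Fin n))
    (u v : Fin n) : |min (defect β k G u) (defect β k G v)| ≤ 1 := by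
  rw [abs_of_nonneg (le_min (defect_nonneg hβ k G u) (defect_nonneg hβ k G v))]
  exact (min_le_left _ _).trans (defect_le_one β k G u)

theorem abs_min_defect_mul_le_one (hn : 2 ≤ n) {β : ℝ} (hβ : 0 < β) (k : ℝ)
    (G : SimpleGraph (Fin n)) (u v : Fin n) :
    |min (defect β k G u) (defect β k G v) * centeredAdj G u v| ≤ 1 := by
  rw [abs_mul]
  exact mul_le_one₀ (abs_min_defect_le_one hβ k G u v) (abs_nonneg _) (abs_centeredAdj_le G hn u v)

theorem AdjacentAt.abs_min_defect_mul_sub_le {i : Fin n} {G G' : SimpleGraph (Fin n)}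
    (h : AdjacentAt i G G') (hn : 2 ≤ n) {β k : ℝ} (hβ : 0 < β) (hk : 0 ≤ k) (u v : Fin n) :
    |min (defect β k G u) (defect β k G v) * centeredAdj G u v
      - min (defect β k G' u) (defect β k G' v) * centeredAdj G' u v| ≤
      6 * β + 2 / n + (if u = i then 2 else 0) + (if v = i then 2 else 0) := by
  have hn0 : (0 : ℝ) ≤ 2 / n := by positivity
  by_cases hi : u = i ∨ v = i
  · have h1 := abs_le.1 (abs_min_defect_mul_le_one hn hβ k G u v)
    have h2 := abs_le.1 (abs_min_defect_mul_le_one hn hβ k G' u v)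
    have h3 : (2 : ℝ) ≤ (if u = i then 2 else 0) + (if v = i then 2 else 0) := by
      rcases hi with hu | hv
      · rw [if_pos hu]; split_ifs <;> norm_num
      · rw [if_pos hv]; split_ifs <;> norm_num
    rw [abs_le]
    constructor <;> linarith [h1.1, h1.2, h2.1, h2.2]
  · push Not at hi
    obtain ⟨hu, hv⟩ := hi
    rw [if_neg hu, if_neg hv, add_zero, add_zero]
    have h1 : |min (defect β k G u) (defect β k G v) - min (defect β k G' u) (defect β k G' v)|
        ≤ 6 * β := (abs_min_sub_min_le_max _ _ _ _).trans
          (max_le (h.abs_defect_sub_le hn hβ hk hu) (h.abs_defect_sub_le hn hβ hk hv))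
    set m := min (defect β k G u) (defect β k G v)
    set m' := min (defect β k G' u) (defect β k G' v)
    calc _ = |(m - m') * centeredAdj G u v + m' * (centeredAdj G u v - centeredAdj G' u v)| := by
          ring_nf
      _ ≤ |m - m'| * |centeredAdj G u v| + |m'| * |centeredAdj G u v - centeredAdj G' u v| := by
          refine (abs_add_le _ _).trans ?_
          rw [abs_mul, abs_mul]
      _ ≤ 6 * β * 1 + 1 * (2 / n) := by
          gcongr
          exacts [abs_centeredAdj_le G hn u v, abs_min_defect_le_one hβ k G' u v,
            h.abs_centeredAdj_sub_le hn hu hv]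
      _ = _ := by ring

theorem AdjacentAt.abs_totalVal_sub_le_of_support {i : Fin n} {G G' : SimpleGraph (Fin n)}
    (h : AdjacentAt i G G') (hn : 2 ≤ n) {β k D : ℝ} (hβ : 0 < β) (hk : 0 ≤ k)
    (hD : k + 3 * kG k G + 1 / β ≤ D) (hD' : k + 3 * kG k G' + 1 / β ≤ D)
    {B : Finset (Fin n)} (hi : i ∈ B) (hB : ∀ u ∉ B, defect β k G u = 0)
    (hB' : ∀ u ∉ B, defect β k G' u = 0) :
    |totalVal β k G - totalVal β k G'| ≤
      2 + 2 * D + B.card * (6 * β * D + 3) + (6 * β * B.card ^ 2 + 6 * B.card) / 2 := by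
  have hD0 : 0 ≤ D := le_trans (by positivity) hD
  have hn0 : (0 : ℝ) < n := by exact_mod_cast (by omega : 0 < n)
  set S := ∑ u ∈ B.erase i, (defect β k G u * dev G u - defect β k G' u * dev G' u) with hS
  set T := ∑ u ∈ B, ∑ v ∈ B, (min (defect β k G u) (defect β k G v) * centeredAdj G u v
      - min (defect β k G' u) (defect β k G' v) * centeredAdj G' u v) with hT
  -- The edge count changes by `deg G i - deg G' i`. Writing `defect * dev` at `i` as `dev -
  -- vertexWt * dev` cancels this, up to the change of average degree; the weighted deviations are
  -- at most `D`.
  have h1 : totalVal β k G - totalVal β k G' =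
      (avgDegree G - avgDegree G') + vertexWt β k G i * dev G i - vertexWt β k G' i * dev G' i
        - S + T / 2 := by
    have e1 : ∑ u, defect β k G u * dev G u - ∑ u, defect β k G' u * dev G' u =
        (defect β k G i * dev G i - defect β k G' i * dev G' i) + S := by
      rw [hS, Finset.add_sum_erase B (fun u => defect β k G u * dev G u
        - defect β k G' u * dev G' u) hi, ← Finset.sum_sub_distrib]
      refine (Finset.sum_subset (Finset.subset_univ B) fun u _ hu => ?_).symm
      rw [hB u hu, hB' u hu]; ring
    have e2 : ∑ u, ∑ v, min (defect β k G u) (defect β k G v) * centeredAdj G u v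
        - ∑ u, ∑ v, min (defect β k G' u) (defect β k G' v) * centeredAdj G' u v = T := by
      rw [hT, ← Finset.sum_sub_distrib]
      simp only [← Finset.sum_sub_distrib]
      symm
      rw [← Finset.sum_product', ← Finset.sum_product']
      refine Finset.sum_subset (Finset.subset_univ _) fun ⟨u, v⟩ _ huv => ?_
      rw [Finset.mem_product, not_and_or] at huv
      rcases huv with hu | hv
      · rw [hB u hu, hB' u hu, min_eq_left (defect_nonneg hβ k G v),
          min_eq_left (defect_nonneg hβ k G' v)]
        ring
      · rw [hB v hv, hB' v hv, min_eq_right (defect_nonneg hβ k G u),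
          min_eq_right (defect_nonneg hβ k G' u)]
        ring
    have e3 := h.choose_mul_edgeDensity_sub hn
    have e4 : defect β k G i * dev G i = dev G i - vertexWt β k G i * dev G i := by
      unfold defect; ring
    have e5 : defect β k G' i * dev G' i = dev G' i - vertexWt β k G' i * dev G' i := by
      unfold defect; ring
    rw [totalVal_eq β k G hn, totalVal_eq β k G' hn, ← e2]
    rw [e4, e5] at e1
    have e6 : dev G i - dev G' i = (deg G i - deg G' i) - (avgDegree G - avgDegree G') := by
      unfold dev; ring
    linarith
  have hSle : |S| ≤ B.card * (6 * β * D + 3) := by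
    refine (Finset.abs_sum_le_sum_abs _ _).trans ((Finset.sum_le_card_nsmul _ _ _ fun u hu =>
      h.abs_defect_mul_dev_sub_le hn hβ hk hD hD' (Finset.ne_of_mem_erase hu)).trans ?_)
    rw [nsmul_eq_mul]
    gcongr
    exact Finset.erase_subset _ _
  have hTle : |T| ≤ 6 * β * B.card ^ 2 + 6 * B.card := by
    have t1 : |T| ≤ ∑ u ∈ B, ∑ v ∈ B,
        (6 * β + 2 / n + (if u = i then 2 else 0) + (if v = i then 2 else 0)) :=
      (Finset.abs_sum_le_sum_abs _ _).trans (Finset.sum_le_sum fun u _ =>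
        (Finset.abs_sum_le_sum_abs _ _).trans (Finset.sum_le_sum fun v _ =>
          h.abs_min_defect_mul_sub_le hn hβ hk u v))
    refine t1.trans ?_
    simp only [Finset.sum_add_distrib, Finset.sum_const, Finset.sum_ite_eq', hi, if_true,
      nsmul_eq_mul, ← Finset.mul_sum]
    have t2 : (B.card : ℝ) ≤ n := by
      have := Finset.card_le_univ B
      rw [Fintype.card_fin] at this
      exact_mod_cast this
    -- The density shift `2 / n`, summed over the pairs in `B`, costs only `2 * B.card` because
    -- `B.card ≤ n`.
    have t3 : (B.card : ℝ) * (2 / n) ≤ 2 := by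
      rw [mul_div_assoc', div_le_iff₀ hn0]
      linarith
    nlinarith [Nat.cast_nonneg (α := ℝ) B.card]
  have h2 := abs_le.1 (h.abs_avgDegree_sub_le hn)
  have h3 := abs_le.1 (abs_vertexWt_mul_dev_le hβ hk hD i)
  have h4 := abs_le.1 (abs_vertexWt_mul_dev_le hβ hk hD' i)
  have h5 := abs_le.1 hSle
  have h6 := abs_le.1 hTle
  rw [h1, abs_le]
  constructor <;> linarith [h2.1, h2.2, h3.1, h3.2, h4.1, h4.2, h5.1, h5.2, h6.1, h6.2]

theorem AdjacentAt.abs_totalVal_sub_le {i : Fin n} {G G' : SimpleGraph (Fin n)}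
    (h : AdjacentAt i G G') (hn : 2 ≤ n) {β k : ℝ} (hβ : 0 < β) (hk : 0 ≤ k) :
    |totalVal β k G - totalVal β k G'| ≤ 200 * sensBound β k (kG k G) := by
  classical
  have hx1 : (1 : ℝ) ≤ kG k G := by exact_mod_cast (kG_spec k G).1
  have hx' : (kG k G' : ℝ) ≤ kG k G + 1 := by exact_mod_cast h.kG_le hn k
  set bad : SimpleGraph (Fin n) → Finset (Fin n) := fun H =>
    {v | deg H v ∉ degInterval k (kG k H) H} with hbad
  have hcard : ∀ H : SimpleGraph (Fin n), (bad H).card ≤ kG k H := by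
    intro H
    have := (kG_spec k H).2
    rwa [Set.ncard_eq_toFinset_card', Set.toFinset_ofPred] at this
  have hzero : ∀ H : SimpleGraph (Fin n), ∀ u ∉ bad H, defect β k H u = 0 := by
    intro H u hu
    exact defect_eq_zero (by simpa [hbad] using hu)
  set B := insert i (bad G ∪ bad G') with hBdef
  have hb : (B.card : ℝ) ≤ 4 * kG k G := by
    have h1 : B.card ≤ kG k G + kG k G' + 1 :=
      (Finset.card_insert_le _ _).trans (Nat.add_le_add_right
        ((Finset.card_union_le _ _).trans (Nat.add_le_add (hcard G) (hcard G'))) 1)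
    have h2 : (B.card : ℝ) ≤ kG k G + kG k G' + 1 := by exact_mod_cast h1
    linarith
  -- This `D` serves both graphs: `3 * kG k G' ≤ 3 * kG k G + 3 ≤ 6 * kG k G`, as `kG` is positive.
  have hmain := h.abs_totalVal_sub_le_of_support hn (D := k + 6 * kG k G + 1 / β) (B := B) hβ hk
    (by linarith) (by linarith) (Finset.mem_insert_self _ _)
    (fun u hu => hzero G u fun hu' => hu (by simp [hBdef, hu']))
    (fun u hu => hzero G' u fun hu' => hu (by simp [hBdef, hu']))
  refine hmain.trans ?_
  set x : ℝ := (kG k G : ℝ)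
  have hinv : 0 < 1 / β := by positivity
  calc _ ≤ 2 + 2 * (k + 6 * x + 1 / β) + 4 * x * (6 * β * (k + 6 * x + 1 / β) + 3)
        + (6 * β * (4 * x) ^ 2 + 6 * (4 * x)) / 2 := by gcongr
    _ = 2 + 2 * k + 60 * x + 2 * (1 / β) + 24 * (β * x * k) + 192 * (β * x * x) := by
        field_simp
        ring
    -- The largest coefficient is `192`; the constant `2` is absorbed into the `x` term by `1 ≤ x`.
    _ ≤ 200 * sensBound β k x := by
        have h1 : 0 ≤ β * x * k := by positivity
        have h2 : 0 ≤ β * x * x := by positivity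
        have h3 : sensBound β k x = x + k + β * x * x + β * x * k + 1 / β := by
          unfold sensBound; ring
        rw [h3]
        linarith

end Sensitivity

theorem subsingleton_simpleGraph {n : ℕ} (hn : ¬ 2 ≤ n) : Subsingleton (SimpleGraph (Fin n)) := by
  have : Subsingleton (Fin n) := Fin.subsingleton_iff_le_one.2 (by omega)
  refine ⟨fun G G' => ?_⟩
  ext u v
  have huv := Subsingleton.elim u v
  subst huv
  simp

theorem isSensitivityConstant_two_hundred : IsSensitivityConstant 200 := by
  refine ⟨by norm_num, fun n β k hβ hk G => ?_⟩
  have hpos := sensBound_pos hβ hk (Nat.cast_nonneg (kG k G))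
  refine Real.iSup_le (fun G' => ?_) (by positivity)
  by_cases hn : 2 ≤ n
  · obtain ⟨i, hi⟩ := G'.2.exists_adjacentAt
    exact hi.abs_totalVal_sub_le hn hβ hk
  · have := subsingleton_simpleGraph hn
    rw [Subsingleton.elim G'.1 G, sub_self, abs_zero]
    positivity

theorem IsSensitivityConstant.abs_totalVal_sub_le {c : ℝ} (hc : IsSensitivityConstant c) {n : ℕ}
    {β k : ℝ} (hβ : 0 < β) (hk : 0 ≤ k) {G G' : SimpleGraph (Fin n)} (h : NodeAdjacent G G') :
    |totalVal β k G - totalVal β k G'| ≤ c * sensBound β k (kG k G) :=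
  (le_ciSup (f := fun H : {H : SimpleGraph (Fin n) // NodeAdjacent G H} =>
    |totalVal β k G - totalVal β k H.1|) (Set.finite_range _).bddAbove ⟨G', h⟩).trans
    (hc.2 n β k hβ hk G)

/-! ### Measurability of the estimators -/

section Measurability

variable {n : ℕ} (G : SimpleGraph (Fin n))

@[fun_prop]
theorem measurable_kG : Measurable fun k : ℝ => (kG k G : ℝ) :=
  (measurable_from_top (f := fun m : ℕ => (m : ℝ))).comp (kG_antitone G).measurable

@[fun_prop]
theorem measurable_tDist (v : Fin n) : Measurable fun k : ℝ => tDist k G v := by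
  unfold tDist degInterval
  have h : (fun k : ℝ => Metric.infDist (deg G v)
      (Set.Icc (avgDegree G - k - 3 * kG k G) (avgDegree G + k + 3 * kG k G))) = fun k =>
      if avgDegree G - k - 3 * kG k G ≤ avgDegree G + k + 3 * kG k G then
        max 0 (max (avgDegree G - k - 3 * kG k G - deg G v)
          (deg G v - (avgDegree G + k + 3 * kG k G))) else 0 := by
    funext k
    -- For very negative `k` the interval is empty and `infDist` is `0` by convention.
    split_ifs with h
    · exact infDist_Icc h
    · rw [Set.Icc_eq_empty h, Metric.infDist_empty]
  rw [h]
  exact Measurable.ite (measurableSet_le (by fun_prop) (by fun_prop)) (by fun_prop) (by fun_prop)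

theorem measurable_betaOf (ε : ℝ) : Measurable (betaOf ε) := by
  unfold betaOf
  exact Measurable.ite (measurableSet_singleton 0) (by fun_prop) (by fun_prop)

theorem measurable_totalVal {b : ℝ → ℝ} (hb : Measurable b) :
    Measurable fun k => totalVal (b k) k G := by
  unfold totalVal pairVal pairWt vertexWt
  fun_prop

/-- Continuity in `l` reduces the uncountable supremum to one over a countable dense set. -/
theorem measurable_smoothBound (c : ℝ) {b : ℝ → ℝ} (hb : Measurable b) :
    Measurable fun k => smoothBound c (b k) k G := by
  obtain ⟨S, hS, hdense⟩ := TopologicalSpace.exists_countable_dense ℝ≥0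
  have : Countable S := hS.to_subtype
  have h : (fun k => smoothBound c (b k) k G) = fun k => ⨆ l : S,
      c * Real.exp (-b k * (l : ℝ≥0)) * sensBound (b k) k (kG k G + (l : ℝ≥0)) := by
    funext k
    refine (hdense.ciSup' (f := fun l : ℝ≥0 =>
      c * Real.exp (-b k * l) * sensBound (b k) k (kG k G + l)) ?_).symm
    unfold sensBound
    fun_prop
  rw [h]
  unfold sensBound
  exact Measurable.iSup fun l => by fun_prop

theorem measurable_concentratedEstimator (c ε : ℝ) :
    Measurable fun q : ℝ × ℝ => concentratedEstimator c ε q.1 G q.2 := by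
  have h1 := measurable_totalVal G (measurable_betaOf ε)
  have h2 := measurable_smoothBound G c (measurable_betaOf ε)
  exact ((h1.comp measurable_fst).add
    (((h2.comp measurable_fst).div_const ε).mul measurable_snd)).const_mul _

theorem measurable_noisyDensity (ε : ℝ) : Measurable (noisyDensity ε G) := by
  unfold noisyDensity
  fun_prop

theorem measurable_concentrationParam (ε α : ℝ) : Measurable (concentrationParam n ε α) := by
  unfold concentrationParam
  fun_prop

theorem measurable_erEstimator (c ε α : ℝ) : Measurable (erEstimator c ε α G) := by
  have h1 : Measurable fun p => concentrationParam n ε α (noisyDensity ε G p) :=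
    (measurable_concentrationParam ε α).comp (measurable_noisyDensity G ε)
  have h2 : Measurable fun z : ℝ × ℝ => (concentrationParam n ε α (noisyDensity ε G z.1), z.2) :=
    (h1.comp measurable_fst).prodMk measurable_snd
  have h3 : erEstimator c ε α G = (fun q : ℝ × ℝ => concentratedEstimator c ε q.1 G q.2) ∘
      fun z : ℝ × ℝ => (concentrationParam n ε α (noisyDensity ε G z.1), z.2) := by
    funext z
    rw [erEstimator, Function.comp_apply]
  rw [h3]
  exact (measurable_concentratedEstimator G c ε).comp h2

end Measurability

/-! ### Privacy -/

section Privacy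

variable {n : ℕ} {G G' : SimpleGraph (Fin n)}

theorem betaOf_pos {ε k : ℝ} (hε : 0 < ε) (hk : 0 ≤ k) : 0 < betaOf ε k := by
  unfold betaOf
  split_ifs with h
  · exact hε
  · have := hk.lt_of_ne' h
    positivity

theorem betaOf_le (ε k : ℝ) : betaOf ε k ≤ ε := by
  unfold betaOf
  split_ifs
  · exact le_rfl
  · exact min_le_left _ _

/-- For a fixed parameter `k`, the concentrated-degree estimator is private. -/
theorem lintegral_concentratedEstimator_le {c a ε k : ℝ} (hc : IsSensitivityConstant c)
    (ha : 1 ≤ a) (hε : 0 < ε) (hk : 0 ≤ k) (hn : 2 ≤ n) (h : NodeAdjacent G G') {g : ℝ → ℝ≥0∞}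
    (hg : Measurable g) :
    ∫⁻ z, g (concentratedEstimator c ε k G z) ∂(studentT3 a) ≤
      ENNReal.ofReal (Real.exp (7 * ε)) *
        ∫⁻ z, g (concentratedEstimator c ε k G' z) ∂(studentT3 a) := by
  obtain ⟨i, hi⟩ := h.exists_adjacentAt
  have hβ := betaOf_pos hε hk
  have hβε := betaOf_le ε k
  set β := betaOf ε k with hβdef
  have hs := smoothBound_pos hc.1 hβ hk G
  have hs' := smoothBound_pos hc.1 hβ hk G'
  have h1 := smoothBound_le_exp_mul hc.1 hβ hk (hi.symm.kG_le hn k)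
  have h2 := smoothBound_le_exp_mul hc.1 hβ hk (hi.kG_le hn k)
  have h3 := (hc.abs_totalVal_sub_le hβ hk h).trans (le_smoothBound hc.1 hβ hk G)
  have hexp : Real.exp β ≤ Real.exp ε := Real.exp_le_exp.2 hβε
  set s := smoothBound c β k G with hsdef
  set s' := smoothBound c β k G' with hsdef'
  -- Substituting `t + r * w` for the noise turns the estimator on `G` into the estimator on `G'`
  -- with noise `w`.
  have key := lintegral_studentT3_le (a := a) (e := ε) (r := s' / s)
    (t := (totalVal β k G' - totalVal β k G) / (s / ε))
    (g := fun z => g (concentratedEstimator c ε k G z)) ha (by positivity) ?_ ?_ ?_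
    (by unfold concentratedEstimator; fun_prop)
  · refine key.trans (le_of_eq ?_)
    congr 1
    refine lintegral_congr fun z => ?_
    congr 1
    unfold concentratedEstimator
    rw [← hβdef, ← hsdef, ← hsdef']
    field_simp
    ring
  · rw [abs_div, abs_of_pos (by positivity : 0 < s / ε), div_le_iff₀ (by positivity), abs_sub_comm]
    field_simp
    exact h3
  · rw [div_le_iff₀ hs]
    exact h2.trans (by gcongr)
  · rw [mul_div_assoc', le_div_iff₀ hs, one_mul]
    exact h1.trans (by gcongr)

/-- Functions of the noisy edge density are private. -/
theorem lintegral_noisyDensity_le {ε : ℝ} (hε : 0 < ε) (hn : 2 ≤ n) (h : NodeAdjacent G G')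
    {g : ℝ → ℝ≥0∞} (hg : Measurable g) :
    ∫⁻ z, g (noisyDensity ε G z) ∂laplace ≤
      ENNReal.ofReal (Real.exp ε) * ∫⁻ z, g (noisyDensity ε G' z) ∂laplace := by
  obtain ⟨i, hi⟩ := h.exists_adjacentAt
  have hn0 : (0 : ℝ) < n := by exact_mod_cast (by omega : 0 < n)
  refine (lintegral_laplace_le (t := (edgeDensity G' - edgeDensity G) / (2 / (ε * n))) (e := ε)
    ?_ (g := fun z => g (noisyDensity ε G z)) (by unfold noisyDensity; fun_prop)).trans
    (le_of_eq ?_)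
  · rw [abs_div, abs_of_pos (by positivity : 0 < 2 / (ε * n)), div_le_iff₀ (by positivity)]
    refine (hi.symm.abs_edgeDensity_sub_le hn).trans (le_of_eq ?_)
    field_simp
  · congr 1
    refine lintegral_congr fun z => ?_
    congr 1
    unfold noisyDensity
    field_simp
    ring

theorem isNodeDP_erLaw {c a ε α : ℝ} (hc : IsSensitivityConstant c) (ha : 1 ≤ a) (hε : 0 < ε)
    (n : ℕ) : IsNodeDP (erLaw (n := n) a c ε α) (8 * ε) 0 := by
  have := isProbabilityMeasure_studentT3 (lt_of_lt_of_le one_pos ha)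
  have hmeas := fun G : SimpleGraph (Fin n) => measurable_erEstimator G c ε α
  refine ⟨fun G => Measure.isProbabilityMeasure_map (hmeas G).aemeasurable,
    fun G G' h S hS => ?_⟩
  rw [ENNReal.ofReal_zero, add_zero]
  by_cases hn : 2 ≤ n
  · set g : ℝ → ℝ≥0∞ := S.indicator 1 with hgdef
    have hg : Measurable g := measurable_one.indicator hS
    -- `Φ H p` is the conditional probability of `S` on input `H` given the noisy density `p`. Once
    -- `p` is fixed, both graphs use the same concentration parameter, so the fixed-`k` bound
    -- applies.
    set Φ : SimpleGraph (Fin n) → ℝ → ℝ≥0∞ := fun H p =>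
      ∫⁻ z, g (concentratedEstimator c ε (concentrationParam n ε α p) H z) ∂(studentT3 a) with hΦ
    have hpair : Measurable fun q : ℝ × ℝ => (concentrationParam n ε α q.1, q.2) :=
      ((measurable_concentrationParam ε α).comp measurable_fst).prodMk measurable_snd
    have hΦm : ∀ H, Measurable (Φ H) := by
      intro H
      have h1 := hg.comp ((measurable_concentratedEstimator H c ε).comp hpair)
      exact h1.lintegral_prod_right'
    have hlaw : ∀ H, erLaw a c ε α H S = ∫⁻ z, Φ H (noisyDensity ε H z) ∂laplace := by
      intro H
      have hgm : Measurable fun z => g (erEstimator c ε α H z) := hg.comp (hmeas H)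
      rw [erLaw, ← lintegral_indicator_one hS, lintegral_map hg (hmeas H),
        lintegral_prod _ hgm.aemeasurable]
      rfl
    have h1 : ∀ p, Φ G p ≤ ENNReal.ofReal (Real.exp (7 * ε)) * Φ G' p := fun p =>
      lintegral_concentratedEstimator_le hc ha hε (Real.sqrt_nonneg _) hn h hg
    rw [hlaw, hlaw]
    calc ∫⁻ z, Φ G (noisyDensity ε G z) ∂laplace
        ≤ ENNReal.ofReal (Real.exp ε) * ∫⁻ z, Φ G (noisyDensity ε G' z) ∂laplace :=
          lintegral_noisyDensity_le hε hn h (hΦm G)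
      _ ≤ ENNReal.ofReal (Real.exp ε) * (ENNReal.ofReal (Real.exp (7 * ε)) *
            ∫⁻ z, Φ G' (noisyDensity ε G' z) ∂laplace) := by
          have hcomp : Measurable fun z => Φ G' (noisyDensity ε G' z) :=
            (hΦm G').comp (measurable_noisyDensity G' ε)
          rw [← lintegral_const_mul _ hcomp]
          gcongr
          exact h1 _
      _ = ENNReal.ofReal (Real.exp (8 * ε)) * ∫⁻ z, Φ G' (noisyDensity ε G' z) ∂laplace := by
          rw [← mul_assoc, ← ENNReal.ofReal_mul (Real.exp_nonneg _), ← Real.exp_add]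
          ring_nf
  · have := subsingleton_simpleGraph hn
    rw [Subsingleton.elim G G']
    refine le_mul_of_one_le_left zero_le ?_
    rw [ENNReal.one_le_ofReal]
    exact Real.one_le_exp (by positivity)

end Privacy

end NodeDP

end

theorem mainTheorem4 :
    (∃ c : ℝ, NodeDP.IsSensitivityConstant c) ∧
    ∃ C : ℝ, 0 < C ∧
      ∀ c : ℝ, NodeDP.IsSensitivityConstant c →
      ∀ a : ℝ, a = 1 ∨ a = 3 →
      ∀ (n : ℕ) (ε α : ℝ), 0 < ε → 0 < α →
        NodeDP.IsNodeDP (NodeDP.erLaw (n := n) a c ε α) (C * ε) 0 := by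
  refine ⟨⟨200, NodeDP.isSensitivityConstant_two_hundred⟩, 8, by norm_num,
    fun c hc a ha n ε α hε _ => NodeDP.isNodeDP_erLaw hc ?_ hε n⟩
  -- The normalization matters only through `1 ≤ a`.
  rcases ha with rfl | rfl <;> norm_num
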